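/- Let $n$ be a positive integer divisible by $4$, and let $\mathrm{Tr}$ denote the trace from $\mathbb{F}_{2^n}$ to $\mathbb{F}_2$. Call $\alpha\in\mathbb{F}_{2^n}$ a normal element of $\mathbb{F}_{2^n}$ over $\mathbb{F}_2$ if $\alpha,\alpha^{2},\alpha^{2^2},\dots,\alpha^{2^{n-1}}$ form a basis of $\mathbb{F}_{2^n}$ over $\mathbb{F}_2$, and call the vector $$\bigl(\mathrm{Tr}(\alpha^{1+2^i})\bigr)_{0\le i\le n-1}\in\mathbb{F}_2^n$$ the corresponding vector of $\alpha$ (its entry at $i=0$ is $\mathrm{Tr}(\alpha^2)=\mathrm{Tr}(\alpha)$). Then there is a normal element $\alpha$ of $\mathbb{F}_{2^n}$ over $\mathbb{F}_2$ whose corresponding vector has Hamming weight (number of nonzero entries) exactly $3$. Moreover, $3$ is the minimum possible: for every normal element $\beta$ of $\mathbb{F}_{2^n}$ over $\mathbb{F}_2$, the corresponding vector of $\beta$ has Hamming weight at least $3$. -/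

import Mathlib

/-- `α` is a normal element of `K` over the finite field `F` with `q` elements, where `K` has
degree `n` over `F`: the conjugates `α, α^q, …, α^(q^(n-1))` form a basis of `K` over `F`. -/
def IsNormalElement (F : Type*) {K : Type*} [Field F] [Field K] [Algebra F K]
    (n : ℕ) (α : K) : Prop :=
  LinearIndependent F (fun i : Fin n => α ^ (Nat.card F ^ (i : ℕ))) ∧
    Submodule.span F (Set.range (fun i : Fin n => α ^ (Nat.card F ^ (i : ℕ)))) = ⊤

/-- The vector `(Tr(α · α^(q^i)))` with `0 ≤ i ≤ n - 1`, where `Tr` is the trace from `K` to `F`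
and `q` is the number of elements of `F`. -/
noncomputable def correspondingVector (F : Type*) {K : Type*} [Field F] [Field K] [Algebra F K]
    (n : ℕ) (α : K) : Fin n → F :=
  fun i => Algebra.trace F K (α * α ^ (Nat.card F ^ (i : ℕ)))

/-! Let x generate the cyclic group of order n acting by Frobenius, and encode the corresponding
vector of a as A(a) = ∑ Tr(a · a^(2^i)) x^i in the group algebra over F_2. Acting on a by f
multiplies A(a) by f f*, where * inverts group elements (`groupPairing_smul_smul`); if A(a) is a
unit, then a is normal.

Lower bound: a normal a has trace 1. Let b and b² be the sums of the conjugates with even and odd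
exponents; then b + b² = 1, so b³ = 1. Expanding b · b² gives the sum of the odd autocorrelations
below n/2 (`sum_trace_mul_odd`). One of these is nonzero, and with its mirror image and position 0
this makes three.

Existence: write n = mq with m odd and q ≥ 4 a power of 2. In degree m some c has A(c) = 1, since A
is, up to a norm f f*, its own inverse. In degree q, t = x + x⁻¹ is nilpotent and any d of trace 1
has A(d) = 1 + t + O(t²); norms remove the higher terms one at a time. By the Chinese remainder
theorem the product cd in the compositum has A(cd) = 1 + z + z⁻¹ with z of order q, which is a unit
of weight 3. -/

section Pairing

/-! ### Group-algebra valued pairings of an invariant form. -/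

open MonoidAlgebra

/-- The inversion involution of the group algebra of a commutative group. -/
noncomputable def groupAlgebraInv (F G : Type*) [Field F] [CommGroup G] :
    MonoidAlgebra F G →ₐ[F] MonoidAlgebra F G :=
  mapDomainAlgHom F F (invMonoidHom : G →* G)

@[simp]
lemma groupAlgebraInv_single {F G : Type*} [Field F] [CommGroup G] (g : G) (c : F) :
    groupAlgebraInv F G (single g c) = single g⁻¹ c := by
  simp [groupAlgebraInv]

variable {F G V : Type*} [Field F] [CommGroup G] [Fintype G] [AddCommGroup V] [Module F V]

/-- The group-algebra valued pairing attached to a bilinear form on a representation. -/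
noncomputable def groupPairing (ρ : Representation F G V) (B : LinearMap.BilinForm F V)
    (a b : V) : MonoidAlgebra F G :=
  ∑ g, single g (B a (ρ g b))

variable (ρ : Representation F G V) (B : LinearMap.BilinForm F V)

lemma coeff_groupPairing (a b : V) (g : G) : (groupPairing ρ B a b).coeff g = B a (ρ g b) := by
  classical
  simp [groupPairing, coeff_sum, Finsupp.single_apply]

lemma groupPairing_smul_left (hB : ∀ g x y, B (ρ g x) (ρ g y) = B x y)
    (f : MonoidAlgebra F G) (a b : V) :
    groupPairing ρ B (ρ.asAlgebraHom f a) b = f * groupPairing ρ B a b := by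
  induction f using MonoidAlgebra.induction_linear with
  | zero => ext g; simp [coeff_groupPairing]
  | add f₁ f₂ h₁ h₂ =>
    rw [add_mul, ← h₁, ← h₂]
    ext g; simp [coeff_groupPairing]
  | single h c =>
    ext g
    rw [coeff_single_mul_apply, coeff_groupPairing, coeff_groupPairing, ← hB h⁻¹]
    simp [← Module.End.mul_apply, ← map_mul]

lemma groupPairing_smul_right (f : MonoidAlgebra F G) (a b : V) :
    groupPairing ρ B a (ρ.asAlgebraHom f b) = groupAlgebraInv F G f * groupPairing ρ B a b := by
  induction f using MonoidAlgebra.induction_linear with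
  | zero => ext g; simp [coeff_groupPairing]
  | add f₁ f₂ h₁ h₂ =>
    rw [map_add, map_add, add_mul, ← h₁, ← h₂]
    ext g; simp [coeff_groupPairing]
  | single h c =>
    ext g
    rw [groupAlgebraInv_single, coeff_single_mul_apply, coeff_groupPairing, coeff_groupPairing]
    simp [← Module.End.mul_apply, ← map_mul, mul_comm]

lemma groupPairing_smul_smul (hB : ∀ g x y, B (ρ g x) (ρ g y) = B x y)
    (f : MonoidAlgebra F G) (a : V) :
    groupPairing ρ B (ρ.asAlgebraHom f a) (ρ.asAlgebraHom f a) =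
      f * groupAlgebraInv F G f * groupPairing ρ B a a := by
  rw [groupPairing_smul_left ρ B hB, groupPairing_smul_right, mul_assoc]

lemma groupAlgebraInv_groupPairing_self (hB : ∀ g x y, B (ρ g x) (ρ g y) = B x y)
    (hs : ∀ x y, B x y = B y x) (a : V) :
    groupAlgebraInv F G (groupPairing ρ B a a) = groupPairing ρ B a a := by
  conv_lhs => rw [groupPairing, map_sum]
  simp only [groupAlgebraInv_single]
  rw [groupPairing, ← Equiv.sum_comp (Equiv.inv G)]
  refine Finset.sum_congr rfl fun g _ => ?_
  simp only [Equiv.inv_apply, inv_inv]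
  rw [hs, ← hB g]
  simp [← Module.End.mul_apply, ← map_mul]

lemma asAlgebraHom_apply_eq_sum (f : MonoidAlgebra F G) (a : V) :
    ρ.asAlgebraHom f a = ∑ g, f.coeff g • ρ g a := by
  induction f using MonoidAlgebra.induction_linear with
  | zero => simp
  | add f₁ f₂ h₁ h₂ => simp [h₁, h₂, add_smul, Finset.sum_add_distrib]
  | single h c =>
    classical
    simp [Finsupp.single_apply]

lemma asAlgebraHom_injective_of_linearIndependent {a : V}
    (ha : LinearIndependent F fun g => ρ g a) {f : MonoidAlgebra F G}
    (hf : ρ.asAlgebraHom f a = 0) : f = 0 := by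
  rw [asAlgebraHom_apply_eq_sum] at hf
  ext g
  simpa using Fintype.linearIndependent_iff.1 ha _ hf g

/-- A linear relation among the translates of `a` is an `f` with `f • a = 0`; pairing with `a` gives
`f` times a unit equal to zero. -/
lemma linearIndependent_of_isUnit_groupPairing (hB : ∀ g x y, B (ρ g x) (ρ g y) = B x y) {a : V}
    (ha : IsUnit (groupPairing ρ B a a)) : LinearIndependent F fun g => ρ g a := by
  refine Fintype.linearIndependent_iff.2 fun c hc => ?_
  let f : MonoidAlgebra F G := ofCoeff (Finsupp.equivFunOnFinite.symm c)
  have h0 : ρ.asAlgebraHom f a = 0 := by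
    rw [asAlgebraHom_apply_eq_sum]; simpa [f] using hc
  have h1 := groupPairing_smul_left ρ B hB f a a
  have h2 : groupPairing ρ B (0 : V) a = 0 := by ext g; simp [coeff_groupPairing]
  rw [h0, h2, eq_comm, ha.mul_left_eq_zero] at h1
  intro g
  simpa [f] using congrArg (fun x => x.coeff g) h1

/-- The coefficients of the product say that `f • a` is orthogonal to every translate of `a`, hence
to everything. -/
lemma eq_zero_of_mul_groupPairing_eq_zero (hB : ∀ g x y, B (ρ g x) (ρ g y) = B x y)
    (hnd : ∀ x, (∀ y, B x y = 0) → x = 0) {a : V}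
    (ha : LinearIndependent F fun g => ρ g a)
    (hspan : Submodule.span F (Set.range fun g => ρ g a) = ⊤) {f : MonoidAlgebra F G}
    (hf : f * groupPairing ρ B a a = 0) : f = 0 := by
  refine asAlgebraHom_injective_of_linearIndependent ρ ha (hnd _ fun y => ?_)
  rw [← groupPairing_smul_left ρ B hB] at hf
  have hy : y ∈ Submodule.span F (Set.range fun g => ρ g a) := by rw [hspan]; trivial
  induction hy using Submodule.span_induction with
  | mem y hy =>
    obtain ⟨g, rfl⟩ := hy
    simpa [coeff_groupPairing] using congrArg (fun x => x.coeff g) hf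
  | zero => simp
  | add x y _ _ hx hy => simp [hx, hy]
  | smul c x _ hx => simp [hx]

end Pairing

/-! ### Sums over periodic sequences. -/

section RangeSums

lemma sum_range_two_mul {M : Type*} [AddCommMonoid M] (f : ℕ → M) (h : ℕ) :
    ∑ i ∈ Finset.range (2 * h), f i = ∑ i ∈ Finset.range h, (f (2 * i) + f (2 * i + 1)) := by
  induction h with
  | zero => simp
  | succ h ih =>
    rw [Finset.sum_range_succ, ← ih, Nat.mul_succ, Finset.sum_range_succ, Finset.sum_range_succ,
      add_assoc]

lemma sum_range_add_of_periodic {M : Type*} [AddCommMonoid M] {f : ℕ → M} {N : ℕ}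
    (hf : Function.Periodic f N) (c : ℕ) :
    ∑ i ∈ Finset.range N, f (i + c) = ∑ i ∈ Finset.range N, f i := by
  induction c with
  | zero => simp
  | succ c ih =>
    rw [← ih]
    cases N with
    | zero => simp
    | succ N =>
      rw [Finset.sum_range_succ, Finset.sum_range_succ' (fun i => f (i + c))]
      congr 1
      · exact Finset.sum_congr rfl fun i _ => by congr 1; ring
      · rw [← hf (0 + c)]; congr 1; ring

/-- The cross terms of even and odd positions of a periodic sequence, grouped by their odd
difference. -/
lemma sum_even_mul_sum_odd {R : Type*} [CommSemiring R] {s : ℕ → R} {m : ℕ}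
    (hs : Function.Periodic s (4 * m)) :
    (∑ i ∈ Finset.range (2 * m), s (2 * i)) * ∑ i ∈ Finset.range (2 * m), s (2 * i + 1) =
      ∑ e ∈ Finset.range m, ∑ k ∈ Finset.range (4 * m), s k * s (k + (2 * e + 1)) := by
  have hper : ∀ c d, Function.Periodic (fun i => s (2 * i + c) * s (2 * i + d)) (2 * m) := by
    intro c d i
    simp only
    rw [← hs (2 * i + c), ← hs (2 * i + d)]
    congr 2 <;> ring
  let S : ℕ → R := fun e => ∑ i ∈ Finset.range (2 * m), s (2 * i) * s (2 * i + (2 * e + 1))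
  have hleft : (∑ i ∈ Finset.range (2 * m), s (2 * i)) * ∑ i ∈ Finset.range (2 * m), s (2 * i + 1) =
      ∑ e ∈ Finset.range (2 * m), S e := by
    simp only [S]
    rw [Finset.sum_comm, Finset.sum_mul]
    refine Finset.sum_congr rfl fun i _ => ?_
    rw [← Finset.mul_sum]
    congr 1
    have hodd : Function.Periodic (fun j => s (2 * j + 1)) (2 * m) := fun j => by
      simp only
      rw [← hs (2 * j + 1)]; congr 1; ring
    rw [← sum_range_add_of_periodic hodd i]
    exact Finset.sum_congr rfl fun j _ => by congr 1; ring
  -- The offset attached to `2 * m - 1 - e` is `4 * m - (2 * e + 1)`, the negative of the offset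
  -- attached to `e`.
  have hsplit : ∑ e ∈ Finset.range (2 * m), S e =
      ∑ e ∈ Finset.range m, (S e + S (2 * m - 1 - e)) := by
    rw [Finset.sum_add_distrib, two_mul, Finset.sum_range_add]
    congr 1
    rw [← Finset.sum_range_reflect]
    refine Finset.sum_congr rfl fun e he => ?_
    rw [Finset.mem_range] at he
    congr 1; omega
  rw [hleft, hsplit]
  refine Finset.sum_congr rfl fun e he => ?_
  rw [Finset.mem_range] at he
  rw [show 4 * m = 2 * (2 * m) by ring, sum_range_two_mul, Finset.sum_add_distrib]
  congr 1
  simp only [S]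
  have := sum_range_add_of_periodic (hper 0 (2 * (2 * m - 1 - e) + 1)) (e + 1)
  simp only [add_zero] at this
  rw [← this]
  refine Finset.sum_congr rfl fun i _ => ?_
  rw [mul_comm, ← hs (2 * i + 1)]
  congr 2 <;> omega

end RangeSums

/-! ### Trace autocorrelations and the lower bound. -/

section Trace

lemma finite_of_card_eq {K : Type*} {n : ℕ} (hK : Nat.card K = 2 ^ n) : Finite K :=
  Nat.finite_of_card_ne_zero (by rw [hK]; positivity)

lemma periodic_frobenius {K : Type*} [Field K] {n : ℕ} (hK : Nat.card K = 2 ^ n) (a : K) :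
    Function.Periodic (fun i => a ^ 2 ^ i) n := fun i => by
  have := finite_of_card_eq hK
  have := Fintype.ofFinite K
  simp only
  rw [pow_add, mul_comm, pow_mul, ← hK, Nat.card_eq_fintype_card, FiniteField.pow_card]

variable {K : Type*} [Field K] [Algebra (ZMod 2) K] {n : ℕ}

lemma charP_two (K : Type*) [Field K] [Algebra (ZMod 2) K] : CharP K 2 :=
  charP_of_injective_algebraMap (algebraMap (ZMod 2) K).injective 2

lemma finrank_eq_of_card_eq (hK : Nat.card K = 2 ^ n) : Module.finrank (ZMod 2) K = n := by
  have := finite_of_card_eq hK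
  have h := FiniteField.pow_finrank_eq_natCard 2 K
  rw [hK] at h
  exact Nat.pow_right_injective le_rfl h

lemma algebraMap_trace_eq (hK : Nat.card K = 2 ^ n) (a : K) :
    algebraMap (ZMod 2) K (Algebra.trace (ZMod 2) K a) = ∑ i ∈ Finset.range n, a ^ 2 ^ i := by
  have := finite_of_card_eq hK
  rw [FiniteField.algebraMap_trace_eq_sum_pow, finrank_eq_of_card_eq hK, Nat.card_zmod]

lemma trace_pow_two_pow (hK : Nat.card K = 2 ^ n) (a : K) (k : ℕ) :
    Algebra.trace (ZMod 2) K (a ^ 2 ^ k) = Algebra.trace (ZMod 2) K a := by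
  apply (algebraMap (ZMod 2) K).injective
  rw [algebraMap_trace_eq hK, algebraMap_trace_eq hK,
    ← sum_range_add_of_periodic (periodic_frobenius hK a) k]
  exact Finset.sum_congr rfl fun i _ => by rw [← pow_mul, ← pow_add, add_comm]

lemma algebraMap_trace_mul_eq (hK : Nat.card K = 2 ^ n) (a : K) (d : ℕ) :
    algebraMap (ZMod 2) K (Algebra.trace (ZMod 2) K (a * a ^ 2 ^ d)) =
      ∑ i ∈ Finset.range n, a ^ 2 ^ i * a ^ 2 ^ (i + d) := by
  rw [algebraMap_trace_eq hK]
  exact Finset.sum_congr rfl fun i _ => by rw [mul_pow, ← pow_mul, ← pow_add 2, add_comm d]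

lemma trace_mul_self (hK : Nat.card K = 2 ^ n) (a : K) :
    Algebra.trace (ZMod 2) K (a * a ^ 2 ^ 0) = Algebra.trace (ZMod 2) K a := by
  rw [← trace_pow_two_pow hK a 1]
  congr 1; ring

lemma trace_mul_symm (hK : Nat.card K = 2 ^ n) (a : K) {d e : ℕ} (hde : d + e = n) :
    Algebra.trace (ZMod 2) K (a * a ^ 2 ^ d) = Algebra.trace (ZMod 2) K (a * a ^ 2 ^ e) := by
  rw [← trace_pow_two_pow hK (a * a ^ 2 ^ e) d, mul_pow, ← pow_mul, ← pow_add 2, add_comm e, hde,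
    mul_comm]
  have := periodic_frobenius hK a 0
  simp only [zero_add, pow_zero, pow_one] at this
  rw [this]

/-- The terms `i` and `i + h` of the trace coincide and cancel in characteristic 2. -/
lemma trace_mul_half (a : K) {h : ℕ} (hK : Nat.card K = 2 ^ (2 * h)) :
    Algebra.trace (ZMod 2) K (a * a ^ 2 ^ h) = 0 := by
  apply (algebraMap (ZMod 2) K).injective
  have := charP_two K
  rw [algebraMap_trace_mul_eq hK, two_mul, Finset.sum_range_add, map_zero]
  have : ∀ i, a ^ 2 ^ (h + i) * a ^ 2 ^ (h + i + h) = a ^ 2 ^ i * a ^ 2 ^ (i + h) := by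
    intro i
    have := periodic_frobenius hK a i
    simp only at this
    rw [show h + i + h = i + 2 * h by ring, this, mul_comm, add_comm]
  simp only [this]
  exact CharTwo.add_self_eq_zero _

/-- In degree divisible by four, the odd autocorrelations of an element of trace one sum to one. -/
lemma sum_trace_mul_odd {m : ℕ} (hK : Nat.card K = 2 ^ (4 * m)) {a : K}
    (ha : Algebra.trace (ZMod 2) K a = 1) :
    ∑ e ∈ Finset.range m, Algebra.trace (ZMod 2) K (a * a ^ 2 ^ (2 * e + 1)) = 1 := by
  apply (algebraMap (ZMod 2) K).injective
  have := charP_two K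
  rw [map_sum, map_one]
  simp only [algebraMap_trace_mul_eq hK]
  have key := sum_even_mul_sum_odd (periodic_frobenius hK a)
  have htr := algebraMap_trace_eq hK a
  rw [ha, map_one, show 4 * m = 2 * (2 * m) by ring, sum_range_two_mul,
    Finset.sum_add_distrib] at htr
  rw [← key]
  set b := ∑ i ∈ Finset.range (2 * m), a ^ 2 ^ (2 * i) with hb
  have hc : ∑ i ∈ Finset.range (2 * m), a ^ 2 ^ (2 * i + 1) = b ^ 2 := by
    rw [hb, sum_pow_char]
    exact Finset.sum_congr rfl fun i _ => by rw [← pow_mul, pow_succ]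
  rw [hc] at htr ⊢
  have h2 : (2 : K) = 0 := CharTwo.two_eq_zero
  -- From b² + b + 1 = 0 in characteristic 2, b³ - 1 = (b - 1)(b² + b + 1) = 0.
  linear_combination (1 - b) * htr + (b - 1) * h2

lemma exists_trace_mul_odd_ne_zero {m : ℕ} (hK : Nat.card K = 2 ^ (4 * m)) {a : K}
    (ha : Algebra.trace (ZMod 2) K a = 1) :
    ∃ e < m, Algebra.trace (ZMod 2) K (a * a ^ 2 ^ (2 * e + 1)) ≠ 0 := by
  by_contra! h
  have := sum_trace_mul_odd hK ha
  rw [Finset.sum_eq_zero fun e he => h e (Finset.mem_range.1 he)] at this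
  exact zero_ne_one this

lemma ZMod.eq_one_of_ne_zero_two {c : ZMod 2} (hc : c ≠ 0) : c = 1 := by
  revert c; decide

lemma trace_eq_one_of_isNormalElement (hn : 0 < n) (hK : Nat.card K = 2 ^ n) {a : K}
    (ha : IsNormalElement (ZMod 2) n a) : Algebra.trace (ZMod 2) K a = 1 := by
  refine ZMod.eq_one_of_ne_zero_two fun h0 => ?_
  have h := algebraMap_trace_eq hK a
  rw [h0, map_zero, Finset.sum_range] at h
  have := Fintype.linearIndependent_iff.1 ha.1 (fun _ => 1) (by simpa using h.symm) ⟨0, hn⟩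
  exact one_ne_zero this

lemma three_le_hammingNorm {m : ℕ} (hm : 0 < m) (hK : Nat.card K = 2 ^ (4 * m)) {a : K}
    (ha : IsNormalElement (ZMod 2) (4 * m) a) :
    3 ≤ hammingNorm (correspondingVector (ZMod 2) (4 * m) a) := by
  have htr := trace_eq_one_of_isNormalElement (by omega) hK ha
  obtain ⟨e, he, hne⟩ := exists_trace_mul_odd_ne_zero hK htr
  have hne' := hne
  rw [trace_mul_symm hK a (show 2 * e + 1 + (4 * m - (2 * e + 1)) = 4 * m by omega)] at hne'
  -- Since `e < m`, the odd position lies strictly below `2 * m` and so differs from its mirror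
  -- image.
  let s : Finset (Fin (4 * m)) :=
    {⟨0, by omega⟩, ⟨2 * e + 1, by omega⟩, ⟨4 * m - (2 * e + 1), by omega⟩}
  have hs : s.card = 3 := Finset.card_eq_three.2 ⟨_, _, _, by simp, by
    simp only [ne_eq, Fin.mk.injEq]; omega, by simp only [ne_eq, Fin.mk.injEq]; omega, rfl⟩
  rw [← hs, hammingNorm]
  refine Finset.card_le_card fun i hi => ?_
  simp only [s, Finset.mem_insert, Finset.mem_singleton] at hi
  simp only [Finset.mem_filter, Finset.mem_univ, true_and, correspondingVector, Nat.card_zmod]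
  rcases hi with rfl | rfl | rfl
  · simp only [trace_mul_self hK, htr]; exact one_ne_zero
  · exact hne
  · exact hne'

lemma span_eq_top_of_linearIndependent {ι : Type*} [Fintype ι] (hK : Nat.card K = 2 ^ n)
    (hι : Fintype.card ι = n) {v : ι → K} (hv : LinearIndependent (ZMod 2) v) :
    Submodule.span (ZMod 2) (Set.range v) = ⊤ := by
  have := finite_of_card_eq hK
  exact hv.span_eq_top_of_card_eq_finrank' (by rw [hι, finrank_eq_of_card_eq hK])

lemma exists_linearIndependent_frobenius (hK : Nat.card K = 2 ^ n) :
    ∃ a : K, LinearIndependent (ZMod 2) (fun i : Fin n => a ^ 2 ^ (i : ℕ)) := by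
  have := finite_of_card_eq hK
  obtain ⟨a, ha⟩ := exists_linearIndependent_algEquiv_apply (ZMod 2) K
  have hfr := finrank_eq_of_card_eq hK
  refine ⟨a, ?_⟩
  have h := ha.comp (fun i : Fin n => FiniteField.frobeniusAlgEquivOfAlgebraic (ZMod 2) K ^ (i : ℕ))
    (((FiniteField.bijective_frobeniusAlgEquivOfAlgebraic_pow (ZMod 2) K).1).comp
      (finCongr hfr.symm).injective)
  convert h using 2 with i
  simp only [Function.comp_apply, AlgEquiv.coe_pow,
    FiniteField.coe_frobeniusAlgEquivOfAlgebraic_iterate, ZMod.card]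

end Trace

/-! ### The Frobenius action and the autocorrelation. -/

section Frobenius

open MonoidAlgebra

variable {K : Type*} [Field K] [Algebra (ZMod 2) K] {n : ℕ} [NeZero n]

/-- The cyclic group of order `n` acting on a field with `2 ^ n` elements through the powers of
the Frobenius automorphism. -/
noncomputable def frobeniusRep (hK : Nat.card K = 2 ^ n) :
    Representation (ZMod 2) (Multiplicative (ZMod n)) K where
  toFun i :=
    { toFun := fun x => x ^ 2 ^ i.toAdd.val
      map_add' := fun x y => by
        have := charP_two K
        exact add_pow_char_pow x y _ _
      map_smul' := fun c x => by
        rw [smul_pow, ZMod.pow_card_pow, RingHom.id_apply] }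
  map_one' := by ext x; simp
  map_mul' i j := by
    ext x
    simp only [toAdd_mul, ZMod.val_add, LinearMap.coe_mk, AddHom.coe_mk, Module.End.mul_apply]
    rw [← pow_mul, ← pow_add, (periodic_frobenius hK x).map_mod_nat, add_comm]

lemma frobeniusRep_apply (hK : Nat.card K = 2 ^ n) (i : Multiplicative (ZMod n)) (x : K) :
    frobeniusRep hK i x = x ^ 2 ^ i.toAdd.val := rfl

lemma traceForm_frobeniusRep (hK : Nat.card K = 2 ^ n) (i : Multiplicative (ZMod n)) (x y : K) :
    Algebra.traceForm (ZMod 2) K (frobeniusRep hK i x) (frobeniusRep hK i y) =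
      Algebra.traceForm (ZMod 2) K x y := by
  simp only [Algebra.traceForm_apply, frobeniusRep_apply]
  rw [← mul_pow, trace_pow_two_pow hK]

/-- The corresponding vector of an element, as an element of the group algebra of the cyclic
group of order `n`. -/
noncomputable def autocorrelation (hK : Nat.card K = 2 ^ n) (a : K) :
    MonoidAlgebra (ZMod 2) (Multiplicative (ZMod n)) :=
  groupPairing (frobeniusRep hK) (Algebra.traceForm (ZMod 2) K) a a

lemma coeff_autocorrelation (hK : Nat.card K = 2 ^ n) (a : K) (i : Multiplicative (ZMod n)) :
    (autocorrelation hK a).coeff i = Algebra.trace (ZMod 2) K (a * a ^ 2 ^ i.toAdd.val) :=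
  coeff_groupPairing _ _ _ _ _

lemma exists_autocorrelation_eq_mul (hK : Nat.card K = 2 ^ n) (a : K)
    (f : MonoidAlgebra (ZMod 2) (Multiplicative (ZMod n))) :
    ∃ b : K, autocorrelation hK b = f * groupAlgebraInv _ _ f * autocorrelation hK a :=
  ⟨_, groupPairing_smul_smul _ _ (traceForm_frobeniusRep hK) f a⟩

lemma groupAlgebraInv_autocorrelation (hK : Nat.card K = 2 ^ n) (a : K) :
    groupAlgebraInv _ _ (autocorrelation hK a) = autocorrelation hK a :=
  groupAlgebraInv_groupPairing_self _ _ (traceForm_frobeniusRep hK)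
    (fun x y => by simp [Algebra.traceForm_apply, mul_comm]) a

lemma linearIndependent_frobeniusRep_iff (hK : Nat.card K = 2 ^ n) (a : K) :
    LinearIndependent (ZMod 2) (fun i => frobeniusRep hK i a) ↔
      LinearIndependent (ZMod 2) (fun i : Fin n => a ^ 2 ^ (i : ℕ)) := by
  let e : Fin n ≃ Multiplicative (ZMod n) := (ZMod.finEquiv n).toEquiv.trans Multiplicative.ofAdd
  rw [← linearIndependent_equiv e]
  refine iff_of_eq (congrArg _ (funext fun i => ?_))
  simp only [frobeniusRep_apply]
  congr 2
  obtain _ | n := n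
  · exact absurd rfl (NeZero.ne 0)
  · rfl

lemma isNormalElement_of_isUnit_autocorrelation (hK : Nat.card K = 2 ^ n) {a : K}
    (ha : IsUnit (autocorrelation hK a)) : IsNormalElement (ZMod 2) n a := by
  have h := linearIndependent_of_isUnit_groupPairing _ _ (traceForm_frobeniusRep hK) ha
  rw [linearIndependent_frobeniusRep_iff] at h
  rw [IsNormalElement, Nat.card_zmod]
  exact ⟨h, span_eq_top_of_linearIndependent hK (Fintype.card_fin n) h⟩

lemma eq_zero_of_mul_autocorrelation_eq_zero (hK : Nat.card K = 2 ^ n) {a : K}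
    (ha : LinearIndependent (ZMod 2) (fun i : Fin n => a ^ 2 ^ (i : ℕ)))
    {f : MonoidAlgebra (ZMod 2) (Multiplicative (ZMod n))}
    (hf : f * autocorrelation hK a = 0) : f = 0 := by
  have := finite_of_card_eq hK
  have h := (linearIndependent_frobeniusRep_iff hK a).2 ha
  exact eq_zero_of_mul_groupPairing_eq_zero _ _ (traceForm_frobeniusRep hK)
    (traceForm_nondegenerate (ZMod 2) K).1 h
    (span_eq_top_of_linearIndependent hK (by simp [ZMod.card]) h) hf

end Frobenius

/-! ### Odd degree. -/

section CharTwo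

open MonoidAlgebra

lemma charP_two_monoidAlgebra (G : Type*) [Monoid G] : CharP (MonoidAlgebra (ZMod 2) G) 2 :=
  charP_of_injective_algebraMap (algebraMap (ZMod 2) (MonoidAlgebra (ZMod 2) G)).injective 2

lemma monoidAlgebra_pow_two_pow {G : Type*} [CommGroup G] {k : ℕ} (hG : ∀ g : G, g ^ 2 ^ k = g)
    (f : MonoidAlgebra (ZMod 2) G) : f ^ 2 ^ k = f := by
  have := charP_two_monoidAlgebra G
  induction f using MonoidAlgebra.induction_linear with
  | zero => simp
  | add f₁ f₂ h₁ h₂ => rw [add_pow_char_pow, h₁, h₂]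
  | single g c => rw [single_pow, hG, ZMod.pow_card_pow]

/-- A field of odd degree over the field with two elements has a self-dual normal basis. -/
lemma exists_autocorrelation_eq_one {K : Type*} [Field K] [Algebra (ZMod 2) K] {n : ℕ} [NeZero n]
    (hK : Nat.card K = 2 ^ n) (hodd : Odd n) : ∃ a : K, autocorrelation hK a = 1 := by
  obtain ⟨a, ha⟩ := exists_linearIndependent_frobenius hK
  obtain ⟨k, hk⟩ : ∃ k, k + 1 = n.totient :=
    ⟨n.totient - 1, Nat.sub_add_cancel (Nat.totient_pos.2 (NeZero.pos n))⟩
  have hG : ∀ g : Multiplicative (ZMod n), g ^ 2 ^ (k + 1) = g := by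
    intro g
    have h1 : ((2 : ℕ) : ZMod n) ^ n.totient = 1 := by
      have := (ZMod.natCast_eq_natCast_iff _ _ _).2
        (Nat.ModEq.pow_totient (Nat.coprime_two_left.2 hodd))
      simpa using this
    apply Multiplicative.toAdd.injective
    rw [toAdd_pow, nsmul_eq_mul, hk, Nat.cast_pow, h1, one_mul]
  set v := autocorrelation hK a with hv
  have hvp : v ^ 2 ^ (k + 1) = v := monoidAlgebra_pow_two_pow hG v
  -- As `v` is fixed by inversion, the new autocorrelation is `v ^ (2 ^ (k + 1) - 1)`; times `v` it
  -- is `v` again, and `v` is not a zero divisor.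
  obtain ⟨b, hb⟩ := exists_autocorrelation_eq_mul hK a (v ^ (2 ^ k - 1))
  refine ⟨b, ?_⟩
  rw [map_pow, hv, groupAlgebraInv_autocorrelation, ← hv, ← pow_add, ← pow_succ] at hb
  have hpos : 0 < 2 ^ k := by positivity
  refine sub_eq_zero.1 (eq_zero_of_mul_autocorrelation_eq_zero hK ha ?_)
  rw [hb, ← hv, sub_mul, ← pow_succ, one_mul, sub_eq_zero]
  convert hvp using 2
  rw [pow_succ]; omega

end CharTwo

/-! ### Degree a power of two. -/

section PowerOfTwo

open Polynomial

lemma exists_pow_add_pow_eq {R : Type*} [CommRing R] [Algebra (ZMod 2) R] {g g' : R}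
    (hg : g * g' = 1) (d : ℕ) : ∃ P : (ZMod 2)[X],
      g ^ d + g' ^ d = (d : ZMod 2) • (g + g') + (g + g') ^ 2 * aeval (g + g') P := by
  have h2 : (2 : R) = 0 := by
    have := congrArg (algebraMap (ZMod 2) R) (show (2 : ZMod 2) = 0 from rfl)
    simpa only [map_ofNat, map_zero] using this
  induction d using Nat.twoStepInduction with
  | zero => exact ⟨0, by simp; linear_combination h2⟩
  | one => exact ⟨0, by simp⟩
  | more d ih₀ ih₁ =>
    obtain ⟨P₀, h₀⟩ := ih₀
    obtain ⟨P₁, h₁⟩ := ih₁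
    -- Read off from the Dickson recursion D_{d+2} = t D_{d+1} - D_d, where D_d = g^d + g'^d and t =
    -- g + g'.
    refine ⟨C ((d + 1 : ℕ) : ZMod 2) + X * P₁ - P₀, ?_⟩
    simp only [map_sub, map_add, map_mul, aeval_X, Algebra.smul_def, map_natCast]
      at h₀ h₁ ⊢
    push_cast at h₀ h₁ ⊢
    linear_combination (g + g') * h₁ - h₀ - (g ^ d + g' ^ d) * hg - (d + 1) * (g + g') * h2

/-- Pairs `j` with `2 * h - j`; the pair at `j = 0` is zero by `h0`, so `f 0` and the midpoint stand
apart. -/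
lemma sum_range_two_mul_of_symm {M : Type*} [AddCommMonoid M] {f : ℕ → M} {h : ℕ}
    (hf : f (2 * h) = f 0) (h0 : f 0 + f 0 = 0) :
    ∑ i ∈ Finset.range (2 * h), f i =
      f 0 + f h + ∑ j ∈ Finset.range h, (f j + f (2 * h - j)) := by
  have h1 : ∑ j ∈ Finset.range h, f (2 * h - j) + f h =
      ∑ i ∈ Finset.range h, f (h + i) + f (2 * h) := by
    rw [two_mul, ← Finset.sum_range_succ (fun i => f (h + i)) h,
      Finset.sum_range_succ' (fun i => f (h + i)) h, add_zero, ← Finset.sum_range_reflect]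
    congr 1
    refine Finset.sum_congr rfl fun j hj => ?_
    rw [Finset.mem_range] at hj
    congr 1; omega
  rw [Finset.sum_add_distrib, add_assoc, add_left_comm (f h), add_comm (f h), h1, hf, two_mul,
    Finset.sum_range_add]
  calc _ = (f 0 + f 0) + (∑ x ∈ Finset.range h, f x + ∑ x ∈ Finset.range h, f (h + x)) := by
        rw [h0, zero_add]
    _ = _ := by abel

variable {K : Type*} [Field K] [Algebra (ZMod 2) K] {n : ℕ} [NeZero n]

/-- The group-algebra element of the residue `i` in the cyclic group of order `n`. -/
noncomputable def cyclicElement (n : ℕ) (i : ZMod n) :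
    MonoidAlgebra (ZMod 2) (Multiplicative (ZMod n)) :=
  MonoidAlgebra.single (Multiplicative.ofAdd i) 1

lemma cyclicElement_pow {n : ℕ} (i : ZMod n) (k : ℕ) :
    cyclicElement n i ^ k = cyclicElement n (k * i) := by
  rw [cyclicElement, MonoidAlgebra.single_pow, one_pow, ← ofAdd_nsmul, nsmul_eq_mul, cyclicElement]

lemma cyclicElement_zero {n : ℕ} : cyclicElement n 0 = 1 := rfl

lemma cyclicElement_mul {n : ℕ} (i j : ZMod n) :
    cyclicElement n i * cyclicElement n j = cyclicElement n (i + j) := by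
  rw [cyclicElement, cyclicElement, MonoidAlgebra.single_mul_single, ← ofAdd_add, one_mul,
    cyclicElement]

lemma groupAlgebraInv_cyclicElement {n : ℕ} (i : ZMod n) :
    groupAlgebraInv _ _ (cyclicElement n i) = cyclicElement n (-i) := by
  rw [cyclicElement, groupAlgebraInv_single, ← ofAdd_neg, cyclicElement]

lemma autocorrelation_eq_sum (hK : Nat.card K = 2 ^ n) (a : K) :
    autocorrelation hK a = ∑ i ∈ Finset.range n,
      Algebra.trace (ZMod 2) K (a * a ^ 2 ^ i) • cyclicElement n i := by
  ext j
  rw [coeff_autocorrelation, MonoidAlgebra.coeff_sum, Finset.sum_apply',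
    Finset.sum_eq_single (Multiplicative.toAdd j).val]
  · simp [cyclicElement]
  · intro i hi hij
    rw [Finset.mem_range] at hi
    have : Multiplicative.ofAdd (i : ZMod n) ≠ j := by
      rintro rfl
      exact hij (by rw [toAdd_ofAdd, ZMod.val_cast_of_lt hi])
    simp [cyclicElement, this]
  · intro h
    exact absurd (Finset.mem_range.2 (ZMod.val_lt _)) h

/-- The autocorrelation of an element of trace one, expanded in `t = x + x⁻¹`, starts with
`1 + t`. -/
lemma exists_autocorrelation_eq_aeval {m : ℕ} [NeZero (4 * m)] (hK : Nat.card K = 2 ^ (4 * m))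
    {a : K} (ha : Algebra.trace (ZMod 2) K a = 1) {t}
    (ht : t = cyclicElement (4 * m) 1 + cyclicElement (4 * m) (-1)) :
    ∃ P : (ZMod 2)[X], autocorrelation hK a = 1 + t + t ^ 2 * aeval t P := by
  have hchar := charP_two_monoidAlgebra (Multiplicative (ZMod (4 * m)))
  have hg : cyclicElement (4 * m) 1 * cyclicElement (4 * m) (-1) = 1 := by
    rw [cyclicElement_mul, add_neg_cancel, cyclicElement_zero]
  choose P hP using exists_pow_add_pow_eq hg
  rw [← ht] at hP
  let c : ℕ → ZMod 2 := fun i => Algebra.trace (ZMod 2) K (a * a ^ 2 ^ i)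
  -- This is the coefficient of `t`: modulo 2 the factor `j` keeps only odd `j`.
  have hodd : ∑ j ∈ Finset.range (2 * m), c j * (j : ZMod 2) = 1 := by
    rw [sum_range_two_mul, ← sum_trace_mul_odd hK ha]
    refine Finset.sum_congr rfl fun e _ => ?_
    have h2 : (2 : ZMod 2) = 0 := rfl
    simp [c, h2]
  refine ⟨∑ j ∈ Finset.range (2 * m), C (c j) * P j, ?_⟩
  have h22 : 4 * m = 2 * (2 * m) := by ring
  have hc0 : c 0 = 1 := by simp only [c]; rw [trace_mul_self hK, ha]
  have hch : c (2 * m) = 0 := trace_mul_half a (by rw [← h22]; exact hK)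
  have hcn : c (4 * m) = 1 := by
    rw [← hc0]; exact trace_mul_symm hK a (by simp)
  rw [autocorrelation_eq_sum]
  change ∑ i ∈ Finset.range (4 * m), c i • cyclicElement (4 * m) i = _
  have key := sum_range_two_mul_of_symm (f := fun i : ℕ => c i • cyclicElement (4 * m) i)
    (h := 2 * m) (by simp only [← h22]; rw [hcn, hc0, ZMod.natCast_self, Nat.cast_zero])
    (CharTwo.add_self_eq_zero _)
  rw [← h22] at key
  rw [key, hc0, hch, Nat.cast_zero, cyclicElement_zero, zero_smul, one_smul, add_zero, add_assoc]
  congr 1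
  have hterm : ∀ j ∈ Finset.range (2 * m), c j • cyclicElement (4 * m) j +
      c (4 * m - j) • cyclicElement (4 * m) ((4 * m - j : ℕ) : ZMod (4 * m)) =
      (c j * (j : ZMod 2)) • t + t ^ 2 * aeval t (C (c j) * P j) := by
    intro j hj
    rw [Finset.mem_range] at hj
    have hcj : c (4 * m - j) = c j := trace_mul_symm hK a (by omega)
    have := hP j
    rw [cyclicElement_pow, cyclicElement_pow, mul_one, mul_neg, mul_one] at this
    rw [hcj, Nat.cast_sub (by omega), ZMod.natCast_self, zero_sub, ← smul_add, this, smul_add,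
      smul_smul, map_mul, aeval_C, Algebra.smul_def (c j) (t ^ 2 * _)]
    ring
  rw [Finset.sum_congr rfl hterm, Finset.sum_add_distrib, ← Finset.sum_smul, hodd, one_smul,
    map_sum, Finset.mul_sum]

/-- In degree a power of two, and at least four, some element has autocorrelation
`1 + x + x⁻¹`. -/
lemma exists_autocorrelation_eq_one_add {s : ℕ} [NeZero (4 * 2 ^ s)]
    (hK : Nat.card K = 2 ^ (4 * 2 ^ s)) :
    ∃ a : K, autocorrelation hK a =
      1 + (cyclicElement (4 * 2 ^ s) 1 + cyclicElement (4 * 2 ^ s) (-1)) := by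
  have hchar := charP_two_monoidAlgebra (Multiplicative (ZMod (4 * 2 ^ s)))
  set t := cyclicElement (4 * 2 ^ s) 1 + cyclicElement (4 * 2 ^ s) (-1) with ht
  have hg : cyclicElement (4 * 2 ^ s) 1 * cyclicElement (4 * 2 ^ s) (-1) = 1 := by
    rw [cyclicElement_mul, add_neg_cancel, cyclicElement_zero]
  have h2 : (2 : MonoidAlgebra (ZMod 2) (Multiplicative (ZMod (4 * 2 ^ s)))) = 0 :=
    CharTwo.two_eq_zero
  have htinv : groupAlgebraInv _ _ t = t := by
    rw [ht, map_add, groupAlgebraInv_cyclicElement, groupAlgebraInv_cyclicElement, neg_neg,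
      add_comm]
  have happrox : ∀ k, ∃ (a : K) (P : (ZMod 2)[X]),
      autocorrelation hK a = 1 + t + t ^ (k + 2) * aeval t P := by
    intro k
    induction k with
    | zero =>
      have := finite_of_card_eq hK
      obtain ⟨a, ha⟩ := Algebra.trace_surjective (ZMod 2) K 1
      exact ⟨a, exists_autocorrelation_eq_aeval hK ha ht⟩
    | succ k ih =>
      obtain ⟨a, P, hP⟩ := ih
      have hdiv := congrArg (aeval t) (divX_mul_X_add P)
      simp only [map_add, map_mul, aeval_X, aeval_C] at hdiv
      by_cases h0 : P.coeff 0 = 0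
      · refine ⟨a, P.divX, ?_⟩
        rw [h0, map_zero] at hdiv
        rw [hP, ← hdiv]; ring
      rw [ZMod.eq_one_of_ne_zero_two h0, map_one] at hdiv
      -- A norm with leading correction `t ^ (k + 2)`. For k = 0 take (1 + t)² = 1 + t²; otherwise
      -- (1 + t^j x)(1 + t^j x⁻¹) = 1 + t^(j+1) + t^(2j) with j = k + 1 ≥ 2.
      obtain ⟨f, Q, hf⟩ : ∃ f, ∃ Q : (ZMod 2)[X],
          f * groupAlgebraInv _ _ f = 1 + t ^ (k + 2) + t ^ (k + 3) * aeval t Q := by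
        obtain rfl | ⟨k, rfl⟩ : k = 0 ∨ ∃ l, k = l + 1 := by
          cases k with
          | zero => exact Or.inl rfl
          | succ l => exact Or.inr ⟨l, rfl⟩
        · refine ⟨1 + t, 0, ?_⟩
          rw [map_add, map_one, htinv, map_zero]
          linear_combination t * h2
        · refine ⟨1 + t ^ (k + 2) * cyclicElement _ 1, X ^ k, ?_⟩
          rw [map_add, map_one, map_mul, map_pow, htinv, groupAlgebraInv_cyclicElement, map_pow,
            aeval_X]
          linear_combination t ^ (2 * k + 4) * hg - t ^ (k + 2) * ht
      obtain ⟨b, hb⟩ := exists_autocorrelation_eq_mul hK a f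
      refine ⟨b, P.divX + 1 + X ^ (k + 1) * P + Q * (1 + X + X ^ (k + 2) * P), ?_⟩
      rw [hb, hf, hP]
      simp only [map_add, map_mul, map_one, map_pow, aeval_X]
      rw [← hdiv]
      linear_combination t ^ (k + 2) * h2
  -- The error then carries `t ^ 2 ^ (s + 1)`, which vanishes: `2 ^ (s + 1)` is half the group
  -- order, hence its own negative.
  obtain ⟨a, P, hP⟩ := happrox (2 * 2 ^ s - 2)
  refine ⟨a, ?_⟩
  have hpos : 0 < 2 ^ s := by positivity
  have hnil : t ^ (2 * 2 ^ s - 2 + 2) = 0 := by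
    rw [Nat.sub_add_cancel (by omega), ← pow_succ', ht, add_pow_char_pow, cyclicElement_pow,
      cyclicElement_pow]
    have : (((2 ^ (s + 1) : ℕ) : ZMod (4 * 2 ^ s)) * -1) =
        ((2 ^ (s + 1) : ℕ) : ZMod (4 * 2 ^ s)) * 1 := by
      rw [mul_neg, mul_one, neg_eq_iff_add_eq_zero, ← Nat.cast_add, ← two_mul,
        show 2 * 2 ^ (s + 1) = 4 * 2 ^ s by ring, ZMod.natCast_self]
    rw [this]
    exact CharTwo.add_self_eq_zero _
  rw [hP, hnil, zero_mul, add_zero]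

end PowerOfTwo

/-! ### Gluing coprime degrees. -/

section Compositum

lemma sum_range_mul_of_coprime {R : Type*} [CommSemiring R] {m q : ℕ} (hm : 0 < m) (hq : 0 < q)
    (hmq : m.Coprime q) {u w : ℕ → R} (hu : Function.Periodic u m) (hw : Function.Periodic w q) :
    ∑ k ∈ Finset.range (m * q), u k * w k =
      (∑ i ∈ Finset.range m, u i) * ∑ j ∈ Finset.range q, w j := by
  rw [Finset.sum_mul_sum, ← Finset.sum_product']
  refine Finset.sum_nbij (fun k => (k % m, k % q)) ?_ ?_ ?_ ?_
  · intro k _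
    simp [Nat.mod_lt _ hm, Nat.mod_lt _ hq]
  · intro k hk l hl hkl
    simp only [Finset.coe_range, Set.mem_Iio] at hk hl
    simp only [Prod.mk.injEq] at hkl
    exact Nat.ModEq.eq_of_lt_of_lt ((Nat.modEq_and_modEq_iff_modEq_mul hmq).1 hkl) hk hl
  · rintro ⟨i, j⟩ hij
    simp only [Finset.coe_product, Finset.coe_range, Set.mem_prod, Set.mem_Iio] at hij
    refine ⟨Nat.chineseRemainder hmq i j, ?_, ?_⟩
    · simpa using Nat.chineseRemainder_lt_mul hmq i j hm.ne' hq.ne'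
    · have h := (Nat.chineseRemainder hmq i j).2
      simp only [Nat.ModEq, Nat.mod_eq_of_lt hij.1, Nat.mod_eq_of_lt hij.2] at h
      simp only [h.1, h.2]
  · intro k _
    simp only [hu.map_mod_nat, hw.map_mod_nat]

variable {K L M : Type*} [Field K] [Algebra (ZMod 2) K] [Field L] [Algebra (ZMod 2) L]
  [Field M] [Algebra (ZMod 2) M]

/-- The two conjugate sequences have coprime periods, so the sum over `m * q` exponents factors. -/
lemma trace_mul_of_coprime {m q : ℕ} (hm : 0 < m) (hq : 0 < q) (hmq : m.Coprime q)
    (hK : Nat.card K = 2 ^ (m * q)) (hL : Nat.card L = 2 ^ m) (hM : Nat.card M = 2 ^ q)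
    (φ : L →ₐ[ZMod 2] K) (ψ : M →ₐ[ZMod 2] K) (x : L) (y : M) :
    Algebra.trace (ZMod 2) K (φ x * ψ y) =
      Algebra.trace (ZMod 2) L x * Algebra.trace (ZMod 2) M y := by
  apply (algebraMap (ZMod 2) K).injective
  have hu : Function.Periodic (fun i => φ (x ^ 2 ^ i)) m := fun i =>
    congrArg φ (periodic_frobenius hL x i)
  have hw : Function.Periodic (fun i => ψ (y ^ 2 ^ i)) q := fun i =>
    congrArg ψ (periodic_frobenius hM y i)
  rw [algebraMap_trace_eq hK, map_mul, ← φ.commutes, ← ψ.commutes, algebraMap_trace_eq hL,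
    algebraMap_trace_eq hM, map_sum, map_sum, ← sum_range_mul_of_coprime hm hq hmq hu hw]
  exact Finset.sum_congr rfl fun i _ => by rw [mul_pow, map_pow, map_pow]

lemma coeff_autocorrelation_natCast {n : ℕ} [NeZero n] (hK : Nat.card K = 2 ^ n) (a : K) (i : ℕ) :
    (autocorrelation hK a).coeff (Multiplicative.ofAdd (i : ZMod n)) =
      Algebra.trace (ZMod 2) K (a * a ^ 2 ^ i) := by
  rw [coeff_autocorrelation, toAdd_ofAdd, ZMod.val_natCast, (periodic_frobenius hK a).map_mod_nat]

lemma coeff_cyclicElement {n : ℕ} (i j : ZMod n) :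
    (cyclicElement n i).coeff (Multiplicative.ofAdd j) = if j = i then 1 else 0 := by
  classical
  rw [cyclicElement, MonoidAlgebra.coeff_single, Finsupp.single_apply]
  simp [eq_comm]

lemma coeff_one_cyclic {n : ℕ} (j : ZMod n) :
    (1 : MonoidAlgebra (ZMod 2) (Multiplicative (ZMod n))).coeff (Multiplicative.ofAdd j) =
      if j = 0 then 1 else 0 := by
  rw [← cyclicElement_zero, coeff_cyclicElement]

/-- The product of elements of coprime degrees, the first with trivial autocorrelation and the
second with autocorrelation `1 + x + x⁻¹`. -/
lemma autocorrelation_mul_eq {m q : ℕ} [NeZero m] [NeZero q] [NeZero (m * q)] (hmq : m.Coprime q)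
    (hK : Nat.card K = 2 ^ (m * q)) (hL : Nat.card L = 2 ^ m) (hM : Nat.card M = 2 ^ q)
    (φ : L →ₐ[ZMod 2] K) (ψ : M →ₐ[ZMod 2] K) {c : L} {d : M} (hc : autocorrelation hL c = 1)
    (hd : autocorrelation hM d = 1 + (cyclicElement q 1 + cyclicElement q (-1))) {z : ZMod (m * q)}
    (hz : z = (ZMod.chineseRemainder hmq).symm (0, 1)) :
    autocorrelation hK (φ c * ψ d) =
      1 + (cyclicElement (m * q) z + cyclicElement (m * q) (-z)) := by
  let e := ZMod.chineseRemainder hmq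
  have hez : e z = (0, 1) := by rw [hz]; exact e.apply_symm_apply _
  ext j
  obtain ⟨j, rfl⟩ := Multiplicative.ofAdd.surjective j
  obtain ⟨i, rfl⟩ := ZMod.natCast_zmod_surjective j
  have hi : e (i : ZMod (m * q)) = ((i : ZMod m), (i : ZMod q)) := by
    rw [map_natCast]; rfl
  have h1 : (i : ZMod (m * q)) = 0 ↔ (i : ZMod m) = 0 ∧ (i : ZMod q) = 0 := by
    rw [← e.injective.eq_iff, hi, map_zero, Prod.mk_eq_zero]
  have h2 : (i : ZMod (m * q)) = z ↔ (i : ZMod m) = 0 ∧ (i : ZMod q) = 1 := by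
    rw [← e.injective.eq_iff, hi, hez, Prod.mk_inj]
  have h3 : (i : ZMod (m * q)) = -z ↔ (i : ZMod m) = 0 ∧ (i : ZMod q) = -1 := by
    rw [← e.injective.eq_iff, hi, map_neg, hez, Prod.neg_mk, neg_zero, Prod.mk_inj]
  have hcoeff : Algebra.trace (ZMod 2) K (φ c * ψ d * (φ c * ψ d) ^ 2 ^ i) =
      Algebra.trace (ZMod 2) L (c * c ^ 2 ^ i) * Algebra.trace (ZMod 2) M (d * d ^ 2 ^ i) := by
    rw [← trace_mul_of_coprime (NeZero.pos m) (NeZero.pos q) hmq hK hL hM φ ψ]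
    congr 1
    simp only [map_mul, map_pow]; ring
  rw [coeff_autocorrelation_natCast, hcoeff, ← coeff_autocorrelation_natCast hL,
    ← coeff_autocorrelation_natCast hM, hc, hd]
  simp only [MonoidAlgebra.coeff_add, Finsupp.add_apply, coeff_one_cyclic, coeff_cyclicElement, h1,
    h2, h3]
  by_cases h0 : (i : ZMod m) = 0 <;> simp [h0]

/-- Raising to the power `2 ^ s` sends both outer terms to 1, and they cancel. -/
lemma isUnit_one_add_cyclicElement {n s : ℕ} {z : ZMod n} (hz : ((2 ^ s : ℕ) : ZMod n) * z = 0) :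
    IsUnit (1 + (cyclicElement n z + cyclicElement n (-z))) := by
  have hchar := charP_two_monoidAlgebra (Multiplicative (ZMod n))
  refine IsUnit.of_pow_eq_one (n := 2 ^ s) ?_ (by positivity)
  rw [add_pow_char_pow, add_pow_char_pow, cyclicElement_pow, cyclicElement_pow, mul_neg, hz,
    neg_zero, one_pow, CharTwo.add_self_eq_zero, add_zero]

lemma hammingNorm_eq_three {n : ℕ} [NeZero n] (hK : Nat.card K = 2 ^ n) {a : K} {z : ZMod n}
    (hz : z ≠ 0) (hz2 : z ≠ -z)
    (ha : autocorrelation hK a = 1 + (cyclicElement n z + cyclicElement n (-z))) :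
    hammingNorm (correspondingVector (ZMod 2) n a) = 3 := by
  classical
  have hs : ({0, z, -z} : Finset (ZMod n)).card = 3 :=
    Finset.card_eq_three.2 ⟨0, z, -z, hz.symm, (neg_ne_zero.2 hz).symm, hz2, rfl⟩
  have hv : ∀ i : ℕ, Algebra.trace (ZMod 2) K (a * a ^ 2 ^ i) ≠ 0 ↔
      (i : ZMod n) ∈ ({0, z, -z} : Finset (ZMod n)) := by
    intro i
    rw [← coeff_autocorrelation_natCast hK, ha]
    simp only [MonoidAlgebra.coeff_add, Finsupp.add_apply, coeff_one_cyclic, coeff_cyclicElement,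
      Finset.mem_insert, Finset.mem_singleton]
    by_cases h0 : (i : ZMod n) = 0
    · simp [h0, hz.symm, (neg_ne_zero.2 hz).symm]
    by_cases h1 : (i : ZMod n) = z
    · simp [h1, hz, hz2]
    · simp [h0, h1]
  rw [← hs, hammingNorm]
  refine Finset.card_bij (fun i _ => ((i : ℕ) : ZMod n)) ?_ ?_ ?_
  · intro i hi
    simp only [Finset.mem_filter, Finset.mem_univ, true_and, correspondingVector,
      Nat.card_zmod] at hi
    exact (hv i).1 hi
  · intro i _ j _ hij
    rw [ZMod.natCast_eq_natCast_iff] at hij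
    exact Fin.ext (Nat.ModEq.eq_of_lt_of_lt hij i.2 j.2)
  · intro j hj
    refine ⟨⟨j.val, j.val_lt⟩, ?_, by simp⟩
    simp only [Finset.mem_filter, Finset.mem_univ, true_and, correspondingVector, Nat.card_zmod]
    exact (hv j.val).2 (by simpa using hj)

lemma exists_isNormalElement_hammingNorm_eq_three {m s : ℕ} (hm : Odd m)
    (hK : Nat.card K = 2 ^ (m * (4 * 2 ^ s))) :
    ∃ a : K, IsNormalElement (ZMod 2) (m * (4 * 2 ^ s)) a ∧
      hammingNorm (correspondingVector (ZMod 2) (m * (4 * 2 ^ s)) a) = 3 := by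
  have hq : 4 * 2 ^ s = 2 ^ (s + 2) := by ring
  have : NeZero m := ⟨hm.pos.ne'⟩
  have : NeZero (4 * 2 ^ s) := ⟨by positivity⟩
  have : NeZero (m * (4 * 2 ^ s)) := ⟨mul_ne_zero (NeZero.ne _) (NeZero.ne _)⟩
  have hmq : m.Coprime (4 * 2 ^ s) := by
    rw [hq]; exact Nat.Coprime.pow_right _ (Nat.coprime_two_right.2 hm)
  have hL := GaloisField.card 2 m (NeZero.ne m)
  have hM := GaloisField.card 2 (4 * 2 ^ s) (NeZero.ne _)
  have := finite_of_card_eq hK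
  obtain ⟨φ⟩ := FiniteField.nonempty_algHom_of_finrank_dvd (F := ZMod 2) (K := GaloisField 2 m)
    (L := K) (by rw [finrank_eq_of_card_eq hK, finrank_eq_of_card_eq hL]; exact dvd_mul_right _ _)
  obtain ⟨ψ⟩ := FiniteField.nonempty_algHom_of_finrank_dvd (F := ZMod 2)
    (K := GaloisField 2 (4 * 2 ^ s)) (L := K)
    (by rw [finrank_eq_of_card_eq hK, finrank_eq_of_card_eq hM]; exact dvd_mul_left _ _)
  obtain ⟨c, hc⟩ := exists_autocorrelation_eq_one hL hm
  obtain ⟨d, hd⟩ := exists_autocorrelation_eq_one_add hM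
  obtain ⟨z, hz⟩ : ∃ z, z = (ZMod.chineseRemainder hmq).symm (0, 1) := ⟨_, rfl⟩
  have ha := autocorrelation_mul_eq hmq hK hL hM φ ψ hc hd hz
  have h4 : 4 ≤ 4 * 2 ^ s := Nat.le_mul_of_pos_right _ (by positivity)
  have hez : ZMod.chineseRemainder hmq z = (0, 1) := by
    rw [hz]; exact RingEquiv.apply_symm_apply _ _
  have h2 : ((2 : ℕ) : ZMod (4 * 2 ^ s)) ≠ 0 := by
    rw [ne_eq, ZMod.natCast_eq_zero_iff]
    exact fun h => by have := Nat.le_of_dvd two_pos h; omega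
  -- The second coordinate of `z` is 1, and `2 ≠ 0` modulo `4 * 2 ^ s`.
  have hzz : z ≠ -z := fun h => h2 <| by
    have := congrArg Prod.snd (congrArg (ZMod.chineseRemainder hmq) h)
    rw [map_neg, hez, Prod.snd_neg, eq_neg_iff_add_eq_zero] at this
    rw [← this]; norm_num
  refine ⟨φ c * ψ d, isNormalElement_of_isUnit_autocorrelation hK ?_,
    hammingNorm_eq_three hK (fun h => hzz (by rw [h, neg_zero])) hzz ha⟩
  rw [ha]
  refine isUnit_one_add_cyclicElement (s := s + 2) ((ZMod.chineseRemainder hmq).injective ?_)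
  rw [map_mul, hez, map_natCast, map_zero, ← hq]
  ext
  · simp
  · rw [Prod.snd_mul, Prod.snd_natCast, ZMod.natCast_self, zero_mul, Prod.snd_zero]

end Compositum

theorem mainTheorem5 (n : ℕ) (hn : 0 < n) (h4 : 4 ∣ n)
    (K : Type*) [Field K] [Algebra (ZMod 2) K] (hK : Nat.card K = 2 ^ n) :
    (∃ α : K, IsNormalElement (ZMod 2) n α ∧
      hammingNorm (correspondingVector (ZMod 2) n α) = 3) ∧
    (∀ β : K, IsNormalElement (ZMod 2) n β →
      3 ≤ hammingNorm (correspondingVector (ZMod 2) n β)) := by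
  constructor
  · obtain ⟨r, rfl⟩ := h4
    obtain ⟨s, m, hm, rfl⟩ := Nat.exists_eq_two_pow_mul_odd (n := r) (by omega)
    rw [show 4 * (2 ^ s * m) = m * (4 * 2 ^ s) by ring] at hK ⊢
    exact exists_isNormalElement_hammingNorm_eq_three hm hK
  · obtain ⟨r, rfl⟩ := h4
    exact fun β hβ => three_le_hammingNorm (by omega) hK hβ
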